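/- Let $I\subset\mathbb R$ be an interval with more than one point (open or not, bounded or not). Let $\alpha\colon I\to\mathbb R^3$ be a real-analytic curve that is regular, i.e. $\alpha'(s)\neq 0$ for all $s\in I$, and let $V\colon I\to\mathbb R^3$ be a real-analytic vector field along $\alpha$ with $|V(s)|=1$ and $\langle\alpha'(s),V(s)\rangle=0$ for all $s\in I$. (At an endpoint belonging to $I$, analyticity and derivatives are understood from within $I$.) Suppose that $0\notin\alpha(I)$. Then there is a $-4$-stationary surface containing $\alpha$ whose unit normal along $\alpha$ coincides with $V$. Precisely: there are a domain (non-empty connected open set) $\Omega\subset\mathbb R^2$ with $I\times\{0\}\subset\Omega$, a smooth immersion $X\colon\Omega\to\mathbb R^3\setminus\{0\}$ and a smooth unit normal field $\nu\colon\Omega\to\mathbb R^3$ of $X$ (that is, $|\nu|=1$ and $\langle\nu,X_s\rangle=\langle\nu,X_t\rangle=0$) such that $$H(p)=-4\,\frac{\langle\nu(p),X(p)\rangle}{|X(p)|^2}\qquad\text{for all }p\in\Omega,$$ where $H$ is the mean curvature of $X$ with respect to $\nu$, i.e. the sum of the two principal curvatures (normalised so that a sphere of radius $r$ has $H=2/r$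 for the inward normal), and such that $$X(s,0)=\alpha(s),\qquad \nu(s,0)=V(s)\qquad\text{for all }s\in I.$$ -/

import Mathlib

open scoped ContDiff

noncomputable section

/-- Euclidean 3-space. -/
abbrev E3 : Type := EuclideanSpace ℝ (Fin 3)

/-- The partial derivative of `F` with respect to the `i`-th of the two parameters `(s, t)`. -/
def partialD (i : Fin 2) (F : ℝ × ℝ → E3) (p : ℝ × ℝ) : E3 :=
  fderiv ℝ F p ((![((1 : ℝ), (0 : ℝ)), ((0 : ℝ), (1 : ℝ))] : Fin 2 → ℝ × ℝ) i)

/-- Gram matrix `⟨∂ᵢX, ∂ⱼX⟩` of the first fundamental form. -/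
def firstForm (X : ℝ × ℝ → E3) (p : ℝ × ℝ) : Matrix (Fin 2) (Fin 2) ℝ :=
  Matrix.of fun i j => inner ℝ (partialD i X p) (partialD j X p)

/-- Matrix `⟨∂ᵢ∂ⱼX, ν⟩` of the second fundamental form with respect to the unit normal `ν`. -/
def secondForm (X ν : ℝ × ℝ → E3) (p : ℝ × ℝ) : Matrix (Fin 2) (Fin 2) ℝ :=
  Matrix.of fun i j => inner ℝ (partialD i (partialD j X) p) (ν p)

/-- Matrix of the shape operator `-dν`; its eigenvalues are the principal curvatures. -/
def shapeOperator (X ν : ℝ × ℝ → E3) (p : ℝ × ℝ) : Matrix (Fin 2) (Fin 2) ℝ :=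
  (firstForm X p)⁻¹ * secondForm X ν p

/-- Mean curvature, as the sum of the two principal curvatures
(`2 / r` for a sphere of radius `r` with inward normal). -/
def meanCurvature (X ν : ℝ × ℝ → E3) (p : ℝ × ℝ) : ℝ :=
  (shapeOperator X ν p).trace

/-- `X : Ω → ℝ³` is a smooth immersion of the planar domain `Ω`, oriented by the smooth unit
normal field `ν`. -/
structure IsOrientedSurface (Ω : Set (ℝ × ℝ)) (X ν : ℝ × ℝ → E3) : Prop where
  isOpen : IsOpen Ω
  isConnected : IsConnected Ω
  smooth : ContDiffOn ℝ ∞ X Ω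
  immersion : ∀ p ∈ Ω, Function.Injective (fderiv ℝ X p)
  smooth_normal : ContDiffOn ℝ ∞ ν Ω
  norm_normal : ∀ p ∈ Ω, ‖ν p‖ = 1
  normal_orthogonal : ∀ p ∈ Ω, ∀ i : Fin 2, inner ℝ (ν p) (partialD i X p) = 0

/-- The oriented surface `X : Ω → ℝ³ ∖ {0}` is `a`-stationary: `H = a ⟨ν, X⟩ / |X|²`. -/
structure IsStationarySurface (a : ℝ) (Ω : Set (ℝ × ℝ)) (X ν : ℝ × ℝ → E3) : Prop
    extends IsOrientedSurface Ω X ν where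
  ne_zero : ∀ p ∈ Ω, X p ≠ 0
  stationary : ∀ p ∈ Ω, meanCurvature X ν p = a * (inner ℝ (ν p) (X p) / ‖X p‖ ^ 2)

end

/-! The inversion x ↦ x/|x|² turns minimal surfaces into -4-stationary ones. If X = Y/|Y|² and ν is
the normal N of Y reflected in the plane orthogonal to Y, then H_X = |Y|² H_Y + 4⟨N,Y⟩, while
⟨ν,X⟩/|X|² = -⟨N,Y⟩. Hence H_Y = 0 gives exactly the required equation; this is
`IsStationarySurface.inversion`, proved for conformal harmonic Y, where minimality is just ΔY = 0.

So the statement reduces to the Björling problem for the inverted data: β = α/|α|² and N, the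
reflection of V, again a regular analytic curve with an analytic unit normal field. Schwarz's
formula solves it in `exists_null_curve`: with A, W holomorphic extensions of β, N, the curve Ψ = A
- i∫ W × A' is null, and Re Ψ is a minimal surface through β with normal N. Inverting it, away from
its zeros, returns the original data, because both the inversion and the reflection are involutions.

The formula needs A, W and the primitive on one neighbourhood of the whole interval, which may be
unbounded or contain endpoints. They are built on discs centred on the interval and glued by the
identity theorem. -/

open Filter Topology Metric Set Matrix

/-! ### Holomorphic extension from a real interval -/

/-- The inclusion of `ℝ³` into `ℂ³`. -/
noncomputable def complexify : E3 →L[ℝ] (Fin 3 → ℂ) :=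
  ContinuousLinearMap.pi fun i => Complex.ofRealCLM.comp (EuclideanSpace.proj i)

/-- The coordinatewise real part `ℂ³ → ℝ³`. -/
noncomputable def rePart : (Fin 3 → ℂ) →L[ℝ] E3 :=
  (EuclideanSpace.equiv (Fin 3) ℝ).symm.toContinuousLinearMap.comp
    (ContinuousLinearMap.pi fun i => Complex.reCLM.comp (ContinuousLinearMap.proj i))

@[simp] lemma complexify_apply (x : E3) (i : Fin 3) : complexify x i = (x i : ℂ) := rfl

@[simp] lemma rePart_apply (z : Fin 3 → ℂ) (i : Fin 3) : rePart z i = (z i).re := rfl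

@[simp] lemma rePart_complexify (x : E3) : rePart (complexify x) = x := by
  ext i; simp

/-- A function that is real-analytic at `s` within `J` is, near `s`, the restriction of a
holomorphic function. -/
lemma AnalyticWithinAt.exists_holomorphic_extension {f : ℝ → E3} {J : Set ℝ} {s : ℝ}
    (hf : AnalyticWithinAt ℝ f J s) :
    ∃ r > 0, ∃ G : ℂ → Fin 3 → ℂ, DifferentiableOn ℂ G (ball (s : ℂ) r) ∧
      ∀ x ∈ J, (x : ℂ) ∈ ball (s : ℂ) r → G x = complexify (f x) := by
  obtain ⟨g, hfg, p, hp⟩ := analyticWithinAt_iff_exists_analyticAt.1 hf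
  obtain ⟨C, R, hC, hR, hpn⟩ := p.le_mul_pow_of_radius_pos hp.radius_pos
  have h1 := hasFPowerSeriesAt_iff'.1 hp
  have hfg' : ∀ᶠ x in 𝓝 s, x ∈ insert s J → f x = g x := eventually_nhdsWithin_iff.1 hfg
  obtain ⟨r₀, hr₀, hball⟩ := Metric.eventually_nhds_iff_ball.1 (h1.and hfg')
  -- The coefficients are at most C Rⁿ, so radius 1/(2R) gives the majorant (1/2)ⁿ for the
  -- complexified series. On real points within r₀ the real series converges to g, and f = g on J
  -- there.
  refine ⟨min r₀ (1 / (2 * R)), by positivity,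
    fun z => ∑' n : ℕ, (z - s) ^ n • complexify (p.coeff n), ?_, ?_⟩
  · refine Complex.differentiableOn_tsum_of_summable_norm
      (u := fun n => ‖complexify‖ * C * (1 / 2 : ℝ) ^ n) ?_ ?_ isOpen_ball ?_
    · exact (summable_geometric_of_lt_one (by norm_num) (by norm_num)).mul_left _
    · intro n; fun_prop
    · intro n w hw
      have hw' : ‖w - s‖ ≤ 1 / (2 * R) :=
        (mem_ball_iff_norm.1 hw).le.trans (min_le_right _ _)
      have hcoeff : ‖p.coeff n‖ ≤ C * R ^ n := by
        rw [← FormalMultilinearSeries.norm_apply_eq_norm_coef]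
        exact hpn n
      rw [norm_smul, norm_pow]
      calc ‖w - s‖ ^ n * ‖complexify (p.coeff n)‖
          ≤ (1 / (2 * R)) ^ n * (‖complexify‖ * (C * R ^ n)) := by
            gcongr
            exact (complexify.le_opNorm _).trans (by gcongr)
        _ = ‖complexify‖ * C * (1 / 2 : ℝ) ^ n := by
            rw [div_pow, div_pow, mul_pow]; field_simp
  · intro x hx hxs
    have hx' : x ∈ ball s r₀ := by
      have := (mem_ball.1 hxs).trans_le (min_le_left _ _)
      rwa [Complex.dist_of_im_eq (by simp)] at this
    obtain ⟨hsum, hxg⟩ := hball x hx'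
    rw [hxg (mem_insert_of_mem _ hx)]
    refine ((hsum.mapL complexify).congr_fun ?_).tsum_eq
    intro n
    ext i
    simp

lemma HasDerivAt.comp_ofReal_vector {E : Type*} [NormedAddCommGroup E] [NormedSpace ℂ E]
    {f : ℂ → E} {f' : E} {s : ℝ} (hf : HasDerivAt f f' s) :
    HasDerivAt (fun x : ℝ => f x) f' s := by
  simpa [Function.comp_def] using hf.scomp s (Complex.ofRealCLM.hasDerivAt (x := s))

/-- A real interval accumulates at its midpoint, which is the input the identity theorem asks for.
-/
lemma frequently_nhdsNE_ofReal {P : ℂ → Prop} {a b : ℝ} (hab : a < b)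
    (h : ∀ x ∈ Ioo a b, P x) : ∃ᶠ z in 𝓝[≠] (((a + b) / 2 : ℝ) : ℂ), P z := by
  have ht : Tendsto (fun x : ℝ => (x : ℂ)) (𝓝[≠] ((a + b) / 2)) (𝓝[≠] (((a + b) / 2 : ℝ) : ℂ)) :=
    tendsto_nhdsWithin_iff.2
      ⟨Complex.continuous_ofReal.continuousAt.tendsto.mono_left nhdsWithin_le_nhds,
        eventually_nhdsWithin_of_forall fun x hx => by
        simpa only [mem_compl_iff, mem_singleton_iff, Complex.ofReal_inj] using hx⟩
  refine ht.frequently (Eventually.frequently ?_)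
  have : Ioo a b ∈ 𝓝 ((a + b) / 2) := Ioo_mem_nhds (by linarith) (by linarith)
  exact eventually_nhdsWithin_of_eventually_nhds (Filter.mem_of_superset this h)

/-- Identity theorem for holomorphic functions that agree on a real interval. -/
lemma DifferentiableOn.eqOn_of_eqOn_real {E : Type*} [NormedAddCommGroup E] [NormedSpace ℂ E]
    [CompleteSpace E] {f g : ℂ → E} {U : Set ℂ} (hU : IsOpen U) (hUc : IsPreconnected U)
    (hf : DifferentiableOn ℂ f U) (hg : DifferentiableOn ℂ g U) {a b : ℝ} (hab : a < b)
    (hmem : ∀ x ∈ Ioo a b, (x : ℂ) ∈ U) (h : ∀ x ∈ Ioo a b, f x = g x) : EqOn f g U :=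
  (hf.analyticOnNhd hU).eqOn_of_preconnected_of_frequently_eq (hg.analyticOnNhd hU) hUc
    (hmem _ ⟨by linarith, by linarith⟩) (frequently_nhdsNE_ofReal hab h)

/-- Local holomorphic extensions of a function on a real interval glue. -/
lemma exists_holomorphic_extension_of_local {E : Type*} [NormedAddCommGroup E] [NormedSpace ℂ E]
    [CompleteSpace E] {J : Set ℝ} (hJ : J.OrdConnected) {f : ℝ → E}
    (hloc : ∀ s ∈ J, ∃ r > 0, ∃ G : ℂ → E,
      DifferentiableOn ℂ G (ball (s : ℂ) r) ∧ ∀ x ∈ J, (x : ℂ) ∈ ball (s : ℂ) r → G x = f x) :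
    ∃ (U : Set ℂ) (F : ℂ → E), IsOpen U ∧ DifferentiableOn ℂ F U ∧
      ∀ s ∈ J, (s : ℂ) ∈ U ∧ F s = f s := by
  classical
  choose! r hr G hG hGf using hloc
  -- Two overlapping discs with real centres also overlap in a real interval between the centres.
  -- That interval lies in J by order-connectedness, both extensions equal f on it, and the
  -- intersection of the discs is convex.
  have key : ∀ s ∈ J, ∀ s' ∈ J, s < s' → ∀ z ∈ ball (s : ℂ) (r s) ∩ ball (s' : ℂ) (r s'),
      G s z = G s' z := by
    intro s hs s' hs' hlt z hz
    have hdist : s' - s < r s + r s' := by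
      have h1 := dist_triangle_left (s' : ℂ) (s : ℂ) z
      have h2 := mem_ball.1 hz.1
      have h3 := mem_ball.1 hz.2
      rw [Complex.dist_of_im_eq (by simp)] at h1
      simp only [Complex.ofReal_re, Real.dist_eq, abs_of_pos (sub_pos.2 hlt)] at h1
      linarith
    have hrs := hr s hs
    have hrs' := hr s' hs'
    have hmem : ∀ x ∈ Ioo (max s (s' - r s')) (min s' (s + r s)),
        x ∈ J ∧ (x : ℂ) ∈ ball (s : ℂ) (r s) ∩ ball (s' : ℂ) (r s') := by
      intro x hx
      obtain ⟨⟨h1, h2⟩, h3, h4⟩ : (s < x ∧ s' - r s' < x) ∧ x < s' ∧ x < s + r s := by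
        simpa only [mem_Ioo, max_lt_iff, lt_min_iff] using hx
      refine ⟨hJ.out hs hs' ⟨h1.le, h3.le⟩, ?_, ?_⟩ <;>
      · rw [mem_ball, Complex.dist_of_im_eq (by simp)]
        simp only [Complex.ofReal_re, Real.dist_eq, abs_lt]
        constructor <;> linarith
    refine DifferentiableOn.eqOn_of_eqOn_real (isOpen_ball.inter isOpen_ball)
      ((convex_ball _ _).inter (convex_ball _ _)).isPreconnected
      ((hG s hs).mono inter_subset_left) ((hG s' hs').mono inter_subset_right)
      (a := max s (s' - r s')) (b := min s' (s + r s)) ?_ (fun x hx => (hmem x hx).2) ?_ hz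
    · simp only [max_lt_iff, lt_min_iff]
      refine ⟨⟨hlt, ?_⟩, ?_, ?_⟩ <;> linarith
    · intro x hx
      obtain ⟨h1, h2, h3⟩ := hmem x hx
      rw [hGf s hs x h1 h2, hGf s' hs' x h1 h3]
  have key' : ∀ s ∈ J, ∀ s' ∈ J, ∀ z ∈ ball (s : ℂ) (r s) ∩ ball (s' : ℂ) (r s'),
      G s z = G s' z := by
    intro s hs s' hs' z hz
    rcases lt_trichotomy s s' with h | rfl | h
    · exact key s hs s' hs' h z hz
    · rfl
    · exact (key s' hs' s hs h z hz.symm).symm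
  let U : Set ℂ := ⋃ s ∈ J, ball (s : ℂ) (r s)
  have hUmem : ∀ z, z ∈ U → ∃ s, s ∈ J ∧ z ∈ ball (s : ℂ) (r s) := by
    intro z hz; simpa [U] using hz
  choose! c hc using hUmem
  have hUsub : ∀ s ∈ J, ball (s : ℂ) (r s) ⊆ U := fun s hs =>
    subset_biUnion_of_mem (u := fun s : ℝ => ball (s : ℂ) (r s)) hs
  have hFeq : ∀ s ∈ J, EqOn (fun z => G (c z) z) (G s) (ball (s : ℂ) (r s)) := by
    intro s hs z hz
    obtain ⟨h1, h2⟩ := hc z (hUsub s hs hz)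
    exact key' _ h1 _ hs z ⟨h2, hz⟩
  refine ⟨U, fun z => G (c z) z, isOpen_biUnion fun _ _ => isOpen_ball, ?_, ?_⟩
  · intro z hz
    obtain ⟨h1, h2⟩ := hc z hz
    have := ((hG _ h1).congr (hFeq _ h1)).differentiableAt (isOpen_ball.mem_nhds h2)
    exact this.differentiableWithinAt
  · intro s hs
    have h1 := mem_ball_self (x := (s : ℂ)) (hr s hs)
    exact ⟨hUsub s hs h1, (hFeq s hs h1).trans (hGf s hs s hs h1)⟩

lemma AnalyticOn.exists_holomorphic_extension {f : ℝ → E3} {J : Set ℝ} (hJ : J.OrdConnected)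
    (hf : AnalyticOn ℝ f J) : ∃ (U : Set ℂ) (F : ℂ → Fin 3 → ℂ), IsOpen U ∧
      DifferentiableOn ℂ F U ∧ ∀ s ∈ J, (s : ℂ) ∈ U ∧ F s = complexify (f s) :=
  exists_holomorphic_extension_of_local hJ fun s hs => (hf s hs).exists_holomorphic_extension

/-! ### Connected neighbourhoods and primitives -/

/-- An open neighbourhood of a real interval contains a connected one. -/
lemma exists_connected_open_subset {J : Set ℝ} (hJ : J.OrdConnected) (hJn : J.Nonempty)
    {U : Set ℂ} (hU : IsOpen U) (hJU : ∀ s ∈ J, (s : ℂ) ∈ U) :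
    ∃ W ⊆ U, IsOpen W ∧ IsConnected W ∧ ∀ s ∈ J, (s : ℂ) ∈ W := by
  obtain ⟨s₀, hs₀⟩ := hJn
  have hpre : IsPreconnected ((fun x : ℝ => (x : ℂ)) '' J) :=
    hJ.isPreconnected.image _ Complex.continuous_ofReal.continuousOn
  have hsub : (fun x : ℝ => (x : ℂ)) '' J ⊆ connectedComponentIn U s₀ :=
    hpre.subset_connectedComponentIn (mem_image_of_mem _ hs₀) (image_subset_iff.2 hJU)
  exact ⟨connectedComponentIn U s₀, connectedComponentIn_subset _ _, hU.connectedComponentIn,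
    isConnected_connectedComponentIn_iff.2 (hJU _ hs₀), fun s hs => hsub (mem_image_of_mem _ hs)⟩

/-- A holomorphic function whose restriction to a real interval is real has, near the interval,
a primitive whose restriction to the interval is real. -/
lemma exists_primitive_near_interval {φ : ℂ → Fin 3 → ℂ} {U : Set ℂ} (hU : IsOpen U)
    (hφ : DifferentiableOn ℂ φ U) {J : Set ℝ} (hJ : J.OrdConnected) (hJn : J.Nontrivial)
    (hJU : ∀ s ∈ J, (s : ℂ) ∈ U) (hreal : ∀ s ∈ J, complexify (rePart (φ s)) = φ s) :
    ∃ W ⊆ U, ∃ B : ℂ → Fin 3 → ℂ, IsOpen W ∧ (∀ s ∈ J, (s : ℂ) ∈ W) ∧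
      (∀ z ∈ W, HasDerivAt B (φ z) z) ∧ ∀ s ∈ J, complexify (rePart (B s)) = B s := by
  obtain ⟨a, ha, b, hb, hab⟩ := hJn.exists_lt
  -- The integrand is continuous on all real points of U, an open set containing J, so β has a
  -- two-sided derivative even at endpoints of J.
  let ψ : ℝ → E3 := fun s => rePart (φ s)
  let β : ℝ → E3 := fun s => ∫ x in a..s, ψ x
  have hO : IsOpen {s : ℝ | (s : ℂ) ∈ U} := hU.preimage Complex.continuous_ofReal
  have hψ : ContinuousOn ψ {s : ℝ | (s : ℂ) ∈ U} :=
    rePart.continuous.comp_continuousOn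
      (hφ.continuousOn.comp Complex.continuous_ofReal.continuousOn fun _ h => h)
  have hβ : ∀ s ∈ J, HasDerivAt β (ψ s) s := by
    intro s hs
    refine intervalIntegral.integral_hasDerivAt_right
      (hψ.mono fun x hx => hJU x (hJ.uIcc_subset ha hs hx)).intervalIntegrable
      (hψ.stronglyMeasurableAtFilter hO s (hJU s hs)) (hψ.continuousAt (hO.mem_nhds (hJU s hs)))
  have hloc : ∀ s ∈ J, ∃ r > 0, ∃ G : ℂ → Fin 3 → ℂ, DifferentiableOn ℂ G (ball (s : ℂ) r) ∧
      ∀ x ∈ J, (x : ℂ) ∈ ball (s : ℂ) r → G x = complexify (β x) := by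
    -- U need not be simply connected, so primitives are taken on discs. Normalised to equal β at
    -- the centre, such a primitive minus β has zero derivative along J and therefore vanishes
    -- there.
    intro s hs
    obtain ⟨r, hr, hrU⟩ := Metric.isOpen_iff.1 hU s (hJU s hs)
    obtain ⟨G, hGs, hG⟩ := (hφ.mono hrU).isExactOn_ball.with_val_at (s : ℂ) (complexify (β s))
    refine ⟨r, hr, G, fun z hz => (hG z hz).differentiableAt.differentiableWithinAt, ?_⟩
    intro x hx hxs
    have hball : ∀ y : ℝ, (y : ℂ) ∈ ball (s : ℂ) r ↔ y ∈ ball s r := by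
      intro y
      rw [mem_ball, mem_ball, Complex.dist_of_im_eq (by simp)]; rfl
    have hconv : Convex ℝ (J ∩ ball s r) := hJ.convex.inter (convex_ball _ _)
    have hD : ∀ y ∈ J ∩ ball s r,
        HasDerivWithinAt (fun y : ℝ => G y - complexify (β y)) 0 (J ∩ ball s r) y := by
      rintro y ⟨hy, hys⟩
      have h1 : HasDerivAt (fun y : ℝ => G y) (φ y) y :=
        (hG y ((hball y).2 hys)).comp_ofReal_vector
      have h2 : HasDerivAt (fun y : ℝ => complexify (β y)) (complexify (ψ y)) y :=
        complexify.hasFDerivAt.comp_hasDerivAt y (hβ y hy)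
      have h3 := (h1.sub h2).hasDerivWithinAt (s := J ∩ ball s r)
      rwa [hreal y hy, sub_self] at h3
    have := hconv.norm_image_sub_le_of_norm_hasDerivWithin_le (C := 0) hD (by simp)
      ⟨hs, mem_ball_self hr⟩ ⟨hx, (hball x).1 hxs⟩
    simpa [hGs, sub_eq_zero] using this
  obtain ⟨U', B, hU', hB, hBβ⟩ := exists_holomorphic_extension_of_local hJ hloc
  obtain ⟨W, hWU, hW, hWc, hJW⟩ := exists_connected_open_subset hJ hJn.nonempty (hU.inter hU')
    fun s hs => ⟨hJU s hs, (hBβ s hs).1⟩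
  have hBW : DifferentiableOn ℂ B W := hB.mono fun z hz => (hWU hz).2
  have hIoo : ∀ x ∈ Ioo a b, x ∈ J := fun x hx => hJ.out ha hb ⟨hx.1.le, hx.2.le⟩
  -- After gluing, B is only known to be holomorphic and equal to β on J; connectedness of W
  -- recovers B' = φ from the real interval.
  have hderiv : EqOn (deriv B) φ W := by
    refine DifferentiableOn.eqOn_of_eqOn_real hW hWc.isPreconnected (hBW.deriv hW)
      (hφ.mono fun z hz => (hWU hz).1) hab (fun x hx => hJW x (hIoo x hx)) ?_
    intro x hx
    have h1 : HasDerivAt (fun y : ℝ => B y) (deriv B x) x :=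
      (hBW.differentiableAt (hW.mem_nhds (hJW x (hIoo x hx)))).hasDerivAt.comp_ofReal_vector
    have h2 : HasDerivAt (fun y : ℝ => complexify (β y)) (complexify (ψ x)) x :=
      complexify.hasFDerivAt.comp_hasDerivAt x (hβ x (hIoo x hx))
    rw [← hreal x (hIoo x hx)]
    refine h1.unique (h2.congr_of_eventuallyEq ?_)
    filter_upwards [Ioo_mem_nhds hx.1 hx.2] with y hy using (hBβ y (hIoo y hy)).2
  refine ⟨W, fun z hz => (hWU hz).1, B, hW, hJW, fun z hz => ?_, fun s hs => ?_⟩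
  · rw [← hderiv hz]
    exact (hBW.differentiableAt (hW.mem_nhds hz)).hasDerivAt
  · rw [(hBβ s hs).2, rePart_complexify]

/-! ### Inversion of curves and surfaces -/

/-- The derivative is taken within a set so that one formula serves both the given curve, endpoints
included, and the coordinate lines of a surface. -/
lemma hasDerivWithinAt_inversion {y : ℝ → E3} {y' : E3} {J : Set ℝ} {t : ℝ}
    (hy : HasDerivWithinAt y y' J t) (h0 : y t ≠ 0) :
    HasDerivWithinAt (fun u => (‖y u‖ ^ 2)⁻¹ • y u)
      ((‖y t‖ ^ 2)⁻¹ • y' - (2 * inner ℝ (y t) y' / (‖y t‖ ^ 2) ^ 2) • y t) J t := by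
  have hn : ‖y t‖ ≠ 0 := norm_ne_zero_iff.2 h0
  have hρ : ‖y t‖ ^ 2 ≠ 0 := pow_ne_zero 2 hn
  refine ((hy.norm_sq.fun_inv hρ).fun_smul hy).congr_deriv ?_
  module

lemma hasDerivAt_inversion_deriv {y y₁ : ℝ → E3} {y₂ : E3} {t : ℝ}
    (hy : HasDerivAt y (y₁ t) t) (hy₁ : HasDerivAt y₁ y₂ t) (h0 : y t ≠ 0) :
    HasDerivAt
      (fun u => (‖y u‖ ^ 2)⁻¹ • y₁ u - (2 * inner ℝ (y u) (y₁ u) / (‖y u‖ ^ 2) ^ 2) • y u)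
      ((‖y t‖ ^ 2)⁻¹ • y₂ - (4 * inner ℝ (y t) (y₁ t) / (‖y t‖ ^ 2) ^ 2) • y₁ t -
        (2 * (inner ℝ (y₁ t) (y₁ t) + inner ℝ (y t) y₂) / (‖y t‖ ^ 2) ^ 2 -
          8 * inner ℝ (y t) (y₁ t) ^ 2 / (‖y t‖ ^ 2) ^ 3) • y t) t := by
  have hn : ‖y t‖ ≠ 0 := norm_ne_zero_iff.2 h0
  have hρ : ‖y t‖ ^ 2 ≠ 0 := pow_ne_zero 2 hn
  have h1 := (hy.norm_sq.fun_inv hρ).fun_smul hy₁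
  have h2 := (((hy.inner ℝ hy₁).const_mul 2).fun_div (hy.norm_sq.fun_pow 2)
    (pow_ne_zero 2 hρ)).fun_smul hy
  refine (h1.fun_sub h2).congr_deriv ?_
  match_scalars <;> field_simp <;> ring

/-- The coordinate directions of the parameter plane. -/
abbrev paramDir (i : Fin 2) : ℝ × ℝ := (![((1 : ℝ), (0 : ℝ)), ((0 : ℝ), (1 : ℝ))] : Fin 2 → ℝ × ℝ) i

lemma DifferentiableAt.hasDerivAt_partialD {F : ℝ × ℝ → E3} {p : ℝ × ℝ}
    (hF : DifferentiableAt ℝ F p) (i : Fin 2) :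
    HasDerivAt (fun t : ℝ => F (p + t • paramDir i)) (partialD i F p) 0 :=
  hF.hasFDerivAt.hasLineDerivAt _

lemma partialD_eq_of_hasDerivAt {F : ℝ × ℝ → E3} {p : ℝ × ℝ} (hF : DifferentiableAt ℝ F p)
    {i : Fin 2} {v : E3} (h : HasDerivAt (fun t : ℝ => F (p + t • paramDir i)) v 0) :
    partialD i F p = v :=
  (hF.hasDerivAt_partialD i).unique h

lemma partialD_congr {F G : ℝ × ℝ → E3} {p : ℝ × ℝ} (h : F =ᶠ[𝓝 p] G) (i : Fin 2) :
    partialD i F p = partialD i G p := by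
  rw [partialD, partialD, h.fderiv_eq]

lemma ContDiffOn.partialD {F : ℝ × ℝ → E3} {Ω : Set (ℝ × ℝ)} (hΩ : IsOpen Ω)
    (hF : ContDiffOn ℝ ∞ F Ω) (i : Fin 2) : ContDiffOn ℝ ∞ (partialD i F) Ω :=
  (hF.fderiv_of_isOpen hΩ (by simp)).clm_apply contDiffOn_const

/-- The inversion of a surface in the unit sphere. -/
noncomputable def invertSurface (Y : ℝ × ℝ → E3) (p : ℝ × ℝ) : E3 := (‖Y p‖ ^ 2)⁻¹ • Y p

/-- Reflection of the normal `N` in the plane orthogonal to the position vector. -/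
noncomputable def invertNormal (Y N : ℝ × ℝ → E3) (p : ℝ × ℝ) : E3 :=
  N p - (2 * inner ℝ (N p) (Y p) / ‖Y p‖ ^ 2) • Y p

section Inversion

variable {Ω : Set (ℝ × ℝ)} {Y N : ℝ × ℝ → E3}

lemma ContDiffOn.invertSurface (hY : ContDiffOn ℝ ∞ Y Ω) (h0 : ∀ p ∈ Ω, Y p ≠ 0) :
    ContDiffOn ℝ ∞ (invertSurface Y) Ω :=
  ((hY.norm_sq ℝ).inv fun p hp => by have := h0 p hp; positivity).smul hY

lemma ContDiffOn.invertNormal (hY : ContDiffOn ℝ ∞ Y Ω) (hN : ContDiffOn ℝ ∞ N Ω)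
    (h0 : ∀ p ∈ Ω, Y p ≠ 0) : ContDiffOn ℝ ∞ (invertNormal Y N) Ω :=
  hN.sub (((contDiffOn_const.mul (hN.inner ℝ hY)).div (hY.norm_sq ℝ)
    fun p hp => by have := h0 p hp; positivity).smul hY)

lemma partialD_invertSurface (hΩ : IsOpen Ω) (hY : ContDiffOn ℝ ∞ Y Ω) (h0 : ∀ p ∈ Ω, Y p ≠ 0)
    {p : ℝ × ℝ} (hp : p ∈ Ω) (i : Fin 2) :
    partialD i (invertSurface Y) p = (‖Y p‖ ^ 2)⁻¹ • partialD i Y p -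
      (2 * inner ℝ (Y p) (partialD i Y p) / (‖Y p‖ ^ 2) ^ 2) • Y p := by
  have hd : ∀ {F : ℝ × ℝ → E3}, ContDiffOn ℝ ∞ F Ω → DifferentiableAt ℝ F p := fun hF =>
    (hF.contDiffAt (hΩ.mem_nhds hp)).differentiableAt (by simp)
  refine partialD_eq_of_hasDerivAt (hd (hY.invertSurface h0)) ?_
  have h1 := ((hd hY).hasDerivAt_partialD i).hasDerivWithinAt (s := univ)
  have h2 := hasDerivWithinAt_inversion h1 (by simpa using h0 p hp)
  simp only [zero_smul, add_zero] at h2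
  exact h2.hasDerivAt univ_mem

lemma partialD_partialD_invertSurface (hΩ : IsOpen Ω) (hY : ContDiffOn ℝ ∞ Y Ω)
    (h0 : ∀ p ∈ Ω, Y p ≠ 0) {p : ℝ × ℝ} (hp : p ∈ Ω) (i : Fin 2) :
    partialD i (partialD i (invertSurface Y)) p =
      (‖Y p‖ ^ 2)⁻¹ • partialD i (partialD i Y) p -
        (4 * inner ℝ (Y p) (partialD i Y p) / (‖Y p‖ ^ 2) ^ 2) • partialD i Y p -
        (2 * (inner ℝ (partialD i Y p) (partialD i Y p) +
            inner ℝ (Y p) (partialD i (partialD i Y) p)) / (‖Y p‖ ^ 2) ^ 2 -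
          8 * inner ℝ (Y p) (partialD i Y p) ^ 2 / (‖Y p‖ ^ 2) ^ 3) • Y p := by
  have hd : ∀ {F : ℝ × ℝ → E3}, ContDiffOn ℝ ∞ F Ω → DifferentiableAt ℝ F p := fun hF =>
    (hF.contDiffAt (hΩ.mem_nhds hp)).differentiableAt (by simp)
  refine partialD_eq_of_hasDerivAt (hd ((hY.invertSurface h0).partialD hΩ i)) ?_
  have h1 := (hd hY).hasDerivAt_partialD i
  have h2 := (hd (hY.partialD hΩ i)).hasDerivAt_partialD i
  have h3 := hasDerivAt_inversion_deriv (y := fun t : ℝ => Y (p + t • paramDir i))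
    (y₁ := fun t : ℝ => partialD i Y (p + t • paramDir i))
    (by simpa using h1) h2 (by simpa using h0 p hp)
  simp only [zero_smul, add_zero] at h3
  refine h3.congr_of_eventuallyEq ?_
  have hcont : ContinuousAt (fun t : ℝ => p + t • paramDir i) 0 := by fun_prop
  filter_upwards [hcont (hΩ.mem_nhds (by simpa using hp))] with t ht
  exact partialD_invertSurface hΩ hY h0 ht i

/-- The inversion of a conformally parametrised minimal surface is `-4`-stationary. -/
theorem IsStationarySurface.inversion (hΩ : IsOpen Ω) (hΩc : IsConnected Ω)
    (hY : ContDiffOn ℝ ∞ Y Ω) (hN : ContDiffOn ℝ ∞ N Ω) (h0 : ∀ p ∈ Ω, Y p ≠ 0)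
    (hN1 : ∀ p ∈ Ω, ‖N p‖ = 1) (hNY : ∀ p ∈ Ω, ∀ i, inner ℝ (N p) (partialD i Y p) = 0)
    (himm : ∀ p ∈ Ω, partialD 0 Y p ≠ 0)
    (horth : ∀ p ∈ Ω, inner ℝ (partialD 0 Y p) (partialD 1 Y p) = 0)
    (hconf : ∀ p ∈ Ω, inner ℝ (partialD 1 Y p) (partialD 1 Y p) =
      inner ℝ (partialD 0 Y p) (partialD 0 Y p))
    (hharm : ∀ p ∈ Ω, partialD 0 (partialD 0 Y) p + partialD 1 (partialD 1 Y) p = 0) :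
    IsStationarySurface (-4) Ω (invertSurface Y) (invertNormal Y N) := by
  have hX := hY.invertSurface h0
  have hn : ∀ p ∈ Ω, ‖Y p‖ ≠ 0 := fun p hp => norm_ne_zero_iff.2 (h0 p hp)
  have hρ : ∀ p ∈ Ω, ‖Y p‖ ^ 2 ≠ 0 := fun p hp => pow_ne_zero 2 (hn p hp)
  have hself : ∀ p, inner ℝ (Y p) (Y p) = ‖Y p‖ ^ 2 := fun p => real_inner_self_eq_norm_sq _
  -- Inversion is conformal: the metric is multiplied by |Y|⁻⁴.
  have hgram : ∀ p ∈ Ω, ∀ i j, inner ℝ (partialD i (invertSurface Y) p)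
      (partialD j (invertSurface Y) p) =
        inner ℝ (partialD i Y p) (partialD j Y p) / (‖Y p‖ ^ 2) ^ 2 := by
    intro p hp i j
    have := hn p hp
    rw [partialD_invertSurface hΩ hY h0 hp, partialD_invertSurface hΩ hY h0 hp]
    simp only [inner_sub_left, inner_sub_right, real_inner_smul_left, real_inner_smul_right, hself,
      real_inner_comm (Y p) (partialD i Y p)]
    field_simp
    ring
  have hYν : ∀ p ∈ Ω, inner ℝ (Y p) (invertNormal Y N p) = -inner ℝ (N p) (Y p) := by
    intro p hp
    have := hn p hp
    simp only [invertNormal, inner_sub_right, real_inner_smul_right, hself,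
      real_inner_comm (N p) (Y p)]
    field_simp
    ring
  have hDν : ∀ p ∈ Ω, ∀ i, inner ℝ (partialD i Y p) (invertNormal Y N p) =
      -(2 * inner ℝ (N p) (Y p) / ‖Y p‖ ^ 2 * inner ℝ (Y p) (partialD i Y p)) := by
    intro p hp i
    simp only [invertNormal, inner_sub_right, real_inner_smul_right,
      real_inner_comm (N p) (partialD i Y p), real_inner_comm (Y p) (partialD i Y p), hNY p hp i]
    ring
  -- Only diagonal entries matter, since the first form is a scalar matrix. Divided by the new
  -- metric, each extra term contributes 2⟨N,Y⟩, and the two together give the constant 4.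
  have hsecond : ∀ p ∈ Ω, ∀ i, inner ℝ (partialD i (partialD i (invertSurface Y)) p)
      (invertNormal Y N p) = inner ℝ (N p) (partialD i (partialD i Y) p) / ‖Y p‖ ^ 2 +
        2 * inner ℝ (N p) (Y p) * inner ℝ (partialD i Y p) (partialD i Y p) /
          (‖Y p‖ ^ 2) ^ 2 := by
    intro p hp i
    have := hn p hp
    have h2 : inner ℝ (partialD i (partialD i Y) p) (invertNormal Y N p) =
        inner ℝ (N p) (partialD i (partialD i Y) p) -
          2 * inner ℝ (N p) (Y p) / ‖Y p‖ ^ 2 * inner ℝ (Y p) (partialD i (partialD i Y) p) := by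
      simp only [invertNormal, inner_sub_right, real_inner_smul_right,
        real_inner_comm (N p) (partialD i (partialD i Y) p),
        real_inner_comm (Y p) (partialD i (partialD i Y) p)]
    rw [partialD_partialD_invertSurface hΩ hY h0 hp]
    simp only [inner_sub_left, real_inner_smul_left, hYν p hp, hDν p hp, h2]
    field_simp
    ring
  have hμ : ∀ p ∈ Ω, inner ℝ (partialD 0 Y p) (partialD 0 Y p) ≠ 0 := fun p hp =>
    inner_self_ne_zero.2 (himm p hp)
  refine ⟨⟨hΩ, hΩc, hX, ?_, hY.invertNormal hN h0, ?_, ?_⟩, ?_, ?_⟩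
  · intro p hp
    refine (injective_iff_map_eq_zero _).2 fun v hv => ?_
    have hv' : v.1 • partialD 0 (invertSurface Y) p + v.2 • partialD 1 (invertSurface Y) p = 0 := by
      rw [← hv]
      simp only [partialD, ← map_smul, ← map_add]
      congr 1
      ext <;> simp
    have g00 := hgram p hp 0 0
    have g01 := hgram p hp 0 1
    have g10 := hgram p hp 1 0
    have g11 := hgram p hp 1 1
    rw [horth p hp] at g01
    rw [real_inner_comm (partialD 0 Y p), horth p hp] at g10
    rw [hconf p hp] at g11
    have hne : inner ℝ (partialD 0 Y p) (partialD 0 Y p) / (‖Y p‖ ^ 2) ^ 2 ≠ 0 :=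
      div_ne_zero (hμ p hp) (pow_ne_zero _ (hρ p hp))
    have e0 := congrArg (fun w => inner ℝ (partialD 0 (invertSurface Y) p) w) hv'
    have e1 := congrArg (fun w => inner ℝ (partialD 1 (invertSurface Y) p) w) hv'
    simp only [inner_add_right, real_inner_smul_right, g00, g01, g10, g11, inner_zero_right,
      zero_div, mul_zero, add_zero, zero_add, mul_eq_zero, hne, or_false] at e0 e1
    exact Prod.ext e0 e1
  · intro p hp
    have := hn p hp
    have h : inner ℝ (invertNormal Y N p) (invertNormal Y N p) = (1 : ℝ) := by
      simp only [invertNormal, inner_sub_right, inner_sub_left, real_inner_smul_left,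
        real_inner_smul_right, hself, real_inner_self_eq_norm_sq (N p), hN1 p hp,
        real_inner_comm (N p) (Y p)]
      field_simp
      ring
    rw [real_inner_self_eq_norm_sq] at h
    exact (pow_eq_one_iff_of_nonneg (norm_nonneg _) two_ne_zero).1 h
  · intro p hp i
    have := hn p hp
    rw [real_inner_comm, partialD_invertSurface hΩ hY h0 hp, inner_sub_left, real_inner_smul_left,
      real_inner_smul_left, hYν p hp, hDν p hp]
    field_simp
    ring
  · intro p hp
    exact smul_ne_zero (inv_ne_zero (hρ p hp)) (h0 p hp)
  · intro p hp
    have h0 := hn p hp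
    have h1 := hρ p hp
    have h2 := hμ p hp
    have hc := hconf p hp
    simp only [real_inner_self_eq_norm_sq] at hc
    have hF : firstForm (invertSurface Y) p =
        (inner ℝ (partialD 0 Y p) (partialD 0 Y p) / (‖Y p‖ ^ 2) ^ 2) • 1 := by
      ext i j
      fin_cases i <;> fin_cases j <;>
        simp [firstForm, hgram p hp, horth p hp, hc,
          real_inner_comm (partialD 0 Y p) (partialD 1 Y p)]
    have hinv : (firstForm (invertSurface Y) p)⁻¹ =
        (inner ℝ (partialD 0 Y p) (partialD 0 Y p) / (‖Y p‖ ^ 2) ^ 2)⁻¹ • 1 := by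
      rw [hF]
      refine Matrix.inv_eq_right_inv ?_
      rw [smul_mul_smul_comm, one_mul, mul_inv_cancel₀ (div_ne_zero h2 (pow_ne_zero _ h1)),
        one_smul]
    have hXν : inner ℝ (invertNormal Y N p) (invertSurface Y p) =
        -(inner ℝ (N p) (Y p) / ‖Y p‖ ^ 2) := by
      rw [invertSurface, real_inner_smul_right, real_inner_comm, hYν p hp]
      ring
    have hXn : ‖invertSurface Y p‖ ^ 2 = (‖Y p‖ ^ 2)⁻¹ := by
      rw [← real_inner_self_eq_norm_sq, invertSurface, real_inner_smul_left,
        real_inner_smul_right, hself]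
      field_simp
    -- Harmonicity of Y removes the |Y|² H_Y part of the trace.
    have hsum : inner ℝ (N p) (partialD 0 (partialD 0 Y) p) +
        inner ℝ (N p) (partialD 1 (partialD 1 Y) p) = 0 := by
      rw [← inner_add_right, hharm p hp, inner_zero_right]
    rw [meanCurvature, shapeOperator, hinv, smul_mul_assoc, one_mul, Matrix.trace_smul,
      Matrix.trace_fin_two, hXν, hXn]
    simp only [secondForm, Matrix.of_apply, hsecond p hp, hconf p hp, smul_eq_mul]
    rw [← eq_neg_iff_add_eq_zero] at hsum
    rw [hsum]
    field_simp
    ring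

end Inversion

/-! ### Cross products and the Björling problem -/

/-- The cross product on Euclidean 3-space. -/
noncomputable def crossE3 (a b : E3) : E3 := WithLp.toLp 2 (a.ofLp ⨯₃ b.ofLp)

lemma crossE3_apply (a b : E3) (i : Fin 3) : crossE3 a b i =
    (![a 1 * b 2 - a 2 * b 1, a 2 * b 0 - a 0 * b 2, a 0 * b 1 - a 1 * b 0] : Fin 3 → ℝ) i := by
  simp [crossE3, cross_apply]

lemma inner_E3 (a b : E3) : inner ℝ a b = a 0 * b 0 + a 1 * b 1 + a 2 * b 2 := by
  simp [PiLp.inner_apply, Fin.sum_univ_three, mul_comm]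

lemma complexify_crossE3 (a b : E3) :
    complexify (crossE3 a b) = complexify a ⨯₃ complexify b := by
  ext i
  fin_cases i <;> simp [crossE3_apply, cross_apply]

lemma complexify_dotProduct (a b : E3) :
    complexify a ⬝ᵥ complexify b = ((inner ℝ a b : ℝ) : ℂ) := by
  rw [inner_E3, vec3_dotProduct]
  simp

lemma ContDiffOn.crossE3 {f g : ℝ × ℝ → E3} {Ω : Set (ℝ × ℝ)} (hf : ContDiffOn ℝ ∞ f Ω)
    (hg : ContDiffOn ℝ ∞ g Ω) : ContDiffOn ℝ ∞ (fun p => crossE3 (f p) (g p)) Ω := by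
  rw [contDiffOn_euclidean] at hf hg ⊢
  intro i
  simp only [crossE3_apply]
  fin_cases i
  · exact ((hf 1).mul (hg 2)).sub ((hf 2).mul (hg 1))
  · exact ((hf 2).mul (hg 0)).sub ((hf 0).mul (hg 2))
  · exact ((hf 0).mul (hg 1)).sub ((hf 1).mul (hg 0))

lemma DifferentiableOn.crossProduct {f g : ℂ → Fin 3 → ℂ} {U : Set ℂ}
    (hf : DifferentiableOn ℂ f U) (hg : DifferentiableOn ℂ g U) :
    DifferentiableOn ℂ (fun z => f z ⨯₃ g z) U := by
  rw [differentiableOn_pi] at hf hg ⊢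
  intro i
  simp only [cross_apply]
  fin_cases i
  · exact ((hf 1).fun_mul (hg 2)).fun_sub ((hf 2).fun_mul (hg 1))
  · exact ((hf 2).fun_mul (hg 0)).fun_sub ((hf 0).fun_mul (hg 2))
  · exact ((hf 0).fun_mul (hg 1)).fun_sub ((hf 1).fun_mul (hg 0))

lemma DifferentiableOn.dotProduct {f g : ℂ → Fin 3 → ℂ} {U : Set ℂ}
    (hf : DifferentiableOn ℂ f U) (hg : DifferentiableOn ℂ g U) :
    DifferentiableOn ℂ (fun z => f z ⬝ᵥ g z) U := by
  rw [differentiableOn_pi] at hf hg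
  simp only [vec3_dotProduct]
  exact (((hf 0).fun_mul (hg 0)).fun_add ((hf 1).fun_mul (hg 1))).fun_add
    ((hf 2).fun_mul (hg 2))

/-- For the bilinear (not Hermitian) product, w × a is orthogonal to a and has the same square as a,
so the square of a - i w × a is a·a + i² a·a = 0. -/
lemma dotProduct_sub_I_smul_cross_eq_zero {w a : Fin 3 → ℂ} (hw : w ⬝ᵥ w = 1)
    (hwa : w ⬝ᵥ a = 0) :
    (a - Complex.I • (w ⨯₃ a)) ⬝ᵥ (a - Complex.I • (w ⨯₃ a)) = 0 := by
  have h1 : a ⬝ᵥ w ⨯₃ a = 0 := dot_cross_self w a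
  have h2 : (w ⨯₃ a) ⬝ᵥ a = 0 := by rw [dotProduct_comm, h1]
  have h3 : (w ⨯₃ a) ⬝ᵥ (w ⨯₃ a) = a ⬝ᵥ a := by
    rw [cross_dot_cross, hw, hwa]; ring
  simp only [sub_dotProduct, dotProduct_sub, smul_dotProduct, dotProduct_smul, h1, h2, h3,
    smul_eq_mul]
  linear_combination (a ⬝ᵥ a) * Complex.I_mul_I

lemma Set.OrdConnected.uniqueDiffOn {J : Set ℝ} (hJ : J.OrdConnected) (hJn : J.Nontrivial) :
    UniqueDiffOn ℝ J := by
  obtain ⟨a, ha, b, hb, hab⟩ := hJn.exists_lt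
  refine uniqueDiffOn_convex hJ.convex ⟨(a + b) / 2, ?_⟩
  exact interior_mono (hJ.out ha hb)
    (by rw [interior_Icc]; exact ⟨by linarith, by linarith⟩)

/-- Solution of the Björling problem: a holomorphic null curve whose real part is a minimal
surface that contains `α` and has the normal `V` along it. -/
theorem exists_null_curve {J : Set ℝ} (hJ : J.OrdConnected) (hJn : J.Nontrivial)
    {α V : ℝ → E3} (hα : AnalyticOn ℝ α J) (hV : AnalyticOn ℝ V J)
    (hα_reg : ∀ s ∈ J, derivWithin α J s ≠ 0) (hV_unit : ∀ s ∈ J, ‖V s‖ = 1)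
    (hV_normal : ∀ s ∈ J, inner ℝ (derivWithin α J s) (V s) = 0) :
    ∃ (U : Set ℂ) (Ψ Φ : ℂ → Fin 3 → ℂ), IsOpen U ∧ (∀ z ∈ U, HasDerivAt Ψ (Φ z) z) ∧
      (∀ z ∈ U, Φ z ≠ 0) ∧ (∀ z ∈ U, Φ z ⬝ᵥ Φ z = 0) ∧ ∀ s ∈ J, (s : ℂ) ∈ U ∧
        rePart (Ψ s) = α s ∧ rePart (Φ s) = derivWithin α J s ∧
        rePart (Complex.I • Φ s) = crossE3 (V s) (derivWithin α J s) := by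
  have hud := hJ.uniqueDiffOn hJn
  obtain ⟨U₁, A, hU₁, hA, hAα⟩ := hα.exists_holomorphic_extension hJ
  obtain ⟨U₂, W, hU₂, hW, hWV⟩ := hV.exists_holomorphic_extension hJ
  obtain ⟨U, hUsub, hU, hUc, hJU⟩ := exists_connected_open_subset hJ hJn.nonempty
    (hU₁.inter hU₂) fun s hs => ⟨(hAα s hs).1, (hWV s hs).1⟩
  replace hA : DifferentiableOn ℂ A U := hA.mono fun z hz => (hUsub hz).1
  replace hW : DifferentiableOn ℂ W U := hW.mono fun z hz => (hUsub hz).2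
  have hA' : DifferentiableOn ℂ (deriv A) U := hA.deriv hU
  have hAs : ∀ s ∈ J, deriv A s = complexify (derivWithin α J s) := by
    intro s hs
    have h1 : HasDerivWithinAt (fun x : ℝ => A x) (deriv A s) J s :=
      (hA.differentiableAt (hU.mem_nhds (hJU s hs))).hasDerivAt.comp_ofReal_vector.hasDerivWithinAt
    have h2 : HasDerivWithinAt (fun x : ℝ => complexify (α x))
        (complexify (derivWithin α J s)) J s :=
      complexify.hasFDerivAt.comp_hasDerivWithinAt s
        (hα.differentiableOn s hs).hasDerivWithinAt
    exact (hud s hs).eq_deriv _ h1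
      (h2.congr (fun x hx => (hAα x hx).2) (hAα s hs).2)
  obtain ⟨a, ha, b, hb, hab⟩ := hJn.exists_lt
  have hIoo : ∀ x ∈ Ioo a b, x ∈ J := fun x hx => hJ.out ha hb ⟨hx.1.le, hx.2.le⟩
  -- The bilinear product keeps W·W and W·A' holomorphic, so the relations |V| = 1 and ⟨α',V⟩ = 0
  -- propagate from the interval to U.
  have hWW : EqOn (fun z => W z ⬝ᵥ W z) (fun _ => 1) U :=
    DifferentiableOn.eqOn_of_eqOn_real hU hUc.isPreconnected (hW.dotProduct hW)
      (differentiableOn_const _) hab (fun x hx => hJU x (hIoo x hx)) fun x hx => by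
        have hx := hIoo x hx
        simp only [(hWV x hx).2, complexify_dotProduct, real_inner_self_eq_norm_sq, hV_unit x hx]
        simp
  have hWA : EqOn (fun z => W z ⬝ᵥ deriv A z) (fun _ => 0) U :=
    DifferentiableOn.eqOn_of_eqOn_real hU hUc.isPreconnected (hW.dotProduct hA')
      (differentiableOn_const _) hab (fun x hx => hJU x (hIoo x hx)) fun x hx => by
        have hx := hIoo x hx
        simp only [(hWV x hx).2, hAs x hx, complexify_dotProduct,
          real_inner_comm (derivWithin α J x) (V x), hV_normal x hx]
        simp
  have hcross : ∀ s ∈ J, W s ⨯₃ deriv A s =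
      complexify (crossE3 (V s) (derivWithin α J s)) := fun s hs => by
    rw [(hWV s hs).2, hAs s hs, complexify_crossE3]
  obtain ⟨U', hU'U, B, hU', hJU', hB, hBreal⟩ := exists_primitive_near_interval hU
    (hW.crossProduct hA') hJ hJn hJU fun s hs => by rw [hcross s hs, rePart_complexify]
  let Φ : ℂ → Fin 3 → ℂ := fun z => deriv A z - Complex.I • (W z ⨯₃ deriv A z)
  have hΦ : ContinuousOn Φ U' :=
    (hA'.sub ((hW.crossProduct hA').const_smul Complex.I)).continuousOn.mono hU'U
  have hIre : ∀ v : E3, rePart (Complex.I • complexify v) = 0 := by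
    intro v; ext i; simp
  have hΦs : ∀ s ∈ J, rePart (Φ s) = derivWithin α J s := by
    intro s hs
    simp only [Φ]
    rw [map_sub, hcross s hs, hAs s hs, hIre, rePart_complexify, sub_zero]
  -- Schwarz's formula. On J the primitive B is real, so Re Ψ = α; zeros of Φ, where the immersion
  -- would fail, are discarded, and none lies on J because Re Φ = α' there.
  refine ⟨U' ∩ {z | Φ z ≠ 0}, fun z => A z - Complex.I • B z, Φ, ?_, ?_, fun z hz => hz.2, ?_, ?_⟩
  · exact hΦ.isOpen_inter_preimage hU' isOpen_ne
  · intro z hz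
    exact (hA.differentiableAt (hU.mem_nhds (hU'U hz.1))).hasDerivAt.sub
      ((hB z hz.1).const_smul Complex.I)
  · intro z hz
    exact dotProduct_sub_I_smul_cross_eq_zero (hWW (hU'U hz.1)) (hWA (hU'U hz.1))
  · intro s hs
    refine ⟨⟨hJU' s hs, fun h => hα_reg s hs ?_⟩, ?_, hΦs s hs, ?_⟩
    · rw [← hΦs s hs, h, map_zero]
    · rw [map_sub, ← hBreal s hs, hIre, (hAα s hs).2, rePart_complexify, sub_zero]
    · have : Complex.I • Φ s = Complex.I • complexify (derivWithin α J s) +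
          complexify (crossE3 (V s) (derivWithin α J s)) := by
        simp only [Φ]
        rw [hcross s hs, hAs s hs, smul_sub, smul_smul, Complex.I_mul_I, neg_one_smul,
          sub_neg_eq_add]
      rw [this, map_add, hIre, rePart_complexify, zero_add]

/-! ### Minimal surfaces as real parts of null curves -/

/-- The identification of the parameter plane with `ℂ`. -/
noncomputable def toComplex : (ℝ × ℝ) ≃L[ℝ] ℂ := Complex.equivRealProdCLM.symm

lemma toComplex_ofReal (s : ℝ) : toComplex (s, 0) = s := by
  simp [toComplex, Complex.ext_iff]

lemma toComplex_paramDir_zero : toComplex (paramDir 0) = 1 := by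
  simp [toComplex, Complex.ext_iff]

lemma toComplex_paramDir_one : toComplex (paramDir 1) = Complex.I := by
  simp [toComplex, Complex.ext_iff]

/-- The real part of a holomorphic curve, as a map of two real parameters. -/
noncomputable def realSurface (Ψ : ℂ → Fin 3 → ℂ) (p : ℝ × ℝ) : E3 := rePart (Ψ (toComplex p))

/-- The unit normal of the real part of a holomorphic null curve with derivative `Φ`. -/
noncomputable def nullNormal (Φ : ℂ → Fin 3 → ℂ) (p : ℝ × ℝ) : E3 :=
  (‖rePart (Φ (toComplex p))‖ ^ 2)⁻¹ •
    crossE3 (rePart (Φ (toComplex p))) (rePart (Complex.I • Φ (toComplex p)))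

lemma ContDiffOn.realSurface {Ψ : ℂ → Fin 3 → ℂ} {U : Set ℂ} (hU : IsOpen U)
    (hΨ : DifferentiableOn ℂ Ψ U) : ContDiffOn ℝ ∞ (realSurface Ψ) (toComplex ⁻¹' U) := by
  have h : ContDiffOn ℝ ∞ Ψ U := (hΨ.contDiffOn hU).restrict_scalars ℝ
  exact rePart.contDiff.comp_contDiffOn
    (h.comp toComplex.contDiff.contDiffOn fun p hp => hp)

lemma partialD_realSurface {Ψ : ℂ → Fin 3 → ℂ} {Ψ' : Fin 3 → ℂ} {p : ℝ × ℝ}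
    (h : HasDerivAt Ψ Ψ' (toComplex p)) (i : Fin 2) :
    partialD i (realSurface Ψ) p = rePart (toComplex (paramDir i) • Ψ') := by
  have h1 : HasFDerivAt Ψ (((ContinuousLinearMap.toSpanSingleton ℂ Ψ').restrictScalars ℝ) :
      ℂ →L[ℝ] (Fin 3 → ℂ)) (toComplex p) := h.hasFDerivAt.restrictScalars ℝ
  have h2 := rePart.hasFDerivAt.comp p (h1.comp p toComplex.hasFDerivAt)
  rw [partialD]
  exact congrArg (fun L : ℝ × ℝ →L[ℝ] E3 => L (paramDir i)) h2.fderiv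

/-- With z = x + iy, z·z = |x|² - |y|² + 2i⟨x,y⟩ and Re(iz) = -y. -/
lemma null_vector_conformal {z : Fin 3 → ℂ} (hz : z ⬝ᵥ z = 0) :
    inner ℝ (rePart z) (rePart (Complex.I • z)) = 0 ∧
      inner ℝ (rePart (Complex.I • z)) (rePart (Complex.I • z)) =
        inner ℝ (rePart z) (rePart z) := by
  rw [vec3_dotProduct, Complex.ext_iff] at hz
  simp only [inner_E3, rePart_apply, Pi.smul_apply, smul_eq_mul, Complex.add_re, Complex.add_im,
    Complex.mul_re, Complex.mul_im, Complex.I_re, Complex.I_im, Complex.zero_re,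
    Complex.zero_im] at hz ⊢
  constructor
  · linear_combination (-1 / 2) * hz.2
  · linear_combination -hz.1

/-- Real and imaginary parts of a null vector have equal length, so they vanish together. This makes
the real part of the null curve an immersion. -/
lemma null_vector_rePart_ne_zero {z : Fin 3 → ℂ} (hz : z ⬝ᵥ z = 0) (h0 : z ≠ 0) :
    rePart z ≠ 0 := by
  intro h
  have h1 := (null_vector_conformal hz).2
  rw [h, inner_zero_left, inner_self_eq_zero] at h1
  refine h0 (funext fun i => Complex.ext ?_ ?_)
  · simpa using congrArg (fun v : E3 => v i) h
  · simpa using congrArg (fun v : E3 => v i) h1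

lemma inner_crossE3_left (a b : E3) : inner ℝ (crossE3 a b) a = 0 := by
  simp [inner_E3, crossE3_apply]; ring

lemma inner_crossE3_right (a b : E3) : inner ℝ (crossE3 a b) b = 0 := by
  simp [inner_E3, crossE3_apply]; ring

lemma inner_crossE3_self (a b : E3) : inner ℝ (crossE3 a b) (crossE3 a b) =
    inner ℝ a a * inner ℝ b b - inner ℝ a b ^ 2 := by
  simp only [inner_E3]
  simp [crossE3_apply]; ring

/-- For v orthogonal to a only |a|² v remains; this identifies the normal of the Björling surface
along the curve with the prescribed field. -/
lemma crossE3_crossE3_self (a v : E3) :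
    crossE3 a (crossE3 v a) = inner ℝ a a • v - inner ℝ a v • a := by
  ext i
  rw [inner_E3, inner_E3]
  fin_cases i <;> simp [crossE3_apply] <;> ring

/-- The inversion of the real part of a null curve is `-4`-stationary. -/
theorem IsStationarySurface.of_null_curve {U : Set ℂ} {Ψ Φ : ℂ → Fin 3 → ℂ} (hU : IsOpen U)
    (hUc : IsConnected U) (hΨ : ∀ z ∈ U, HasDerivAt Ψ (Φ z) z) (hΦ0 : ∀ z ∈ U, Φ z ≠ 0)
    (hnull : ∀ z ∈ U, Φ z ⬝ᵥ Φ z = 0) (hne : ∀ z ∈ U, rePart (Ψ z) ≠ 0) :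
    IsStationarySurface (-4) (toComplex ⁻¹' U) (invertSurface (realSurface Ψ))
      (invertNormal (realSurface Ψ) (nullNormal Φ)) := by
  have hdΨ : DifferentiableOn ℂ Ψ U := fun z hz =>
    (hΨ z hz).differentiableAt.differentiableWithinAt
  have hdΦ : DifferentiableOn ℂ Φ U :=
    (hdΨ.deriv hU).congr fun z hz => (hΨ z hz).deriv.symm
  have hIΦ : DifferentiableOn ℂ (fun z => Complex.I • Φ z) U := hdΦ.const_smul Complex.I
  have hΩ : IsOpen (toComplex ⁻¹' U) := hU.preimage toComplex.continuous
  have hpre : ∀ z ∈ U, rePart (Φ z) ≠ 0 := fun z hz =>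
    null_vector_rePart_ne_zero (hnull z hz) (hΦ0 z hz)
  have hD0 : ∀ p ∈ toComplex ⁻¹' U,
      partialD 0 (realSurface Ψ) p = realSurface Φ p := fun p hp => by
    rw [partialD_realSurface (hΨ _ hp), toComplex_paramDir_zero, one_smul]; rfl
  have hD1 : ∀ p ∈ toComplex ⁻¹' U,
      partialD 1 (realSurface Ψ) p = realSurface (fun z => Complex.I • Φ z) p := fun p hp => by
    rw [partialD_realSurface (hΨ _ hp), toComplex_paramDir_one]; rfl
  have hconf := fun p (hp : p ∈ toComplex ⁻¹' U) => null_vector_conformal (hnull _ hp)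
  refine IsStationarySurface.inversion hΩ ?_ (ContDiffOn.realSurface hU hdΨ) ?_
    (fun p hp => hne _ hp) ?_ ?_ ?_ ?_ ?_ ?_
  · exact (toComplex.toHomeomorph.isConnected_preimage).2 hUc
  · exact (((ContDiffOn.realSurface hU hdΦ).norm_sq ℝ).inv fun p hp =>
      pow_ne_zero 2 (norm_ne_zero_iff.2 (hpre _ hp))).smul
        ((ContDiffOn.realSurface hU hdΦ).crossE3 (ContDiffOn.realSurface hU hIΦ))
  · intro p hp
    have h1 : ‖rePart (Φ (toComplex p))‖ ≠ 0 := norm_ne_zero_iff.2 (hpre _ hp)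
    have h2 : ‖nullNormal Φ p‖ ^ 2 = 1 := by
      rw [← real_inner_self_eq_norm_sq, nullNormal, real_inner_smul_left, real_inner_smul_right,
        inner_crossE3_self, (hconf p hp).1, (hconf p hp).2, real_inner_self_eq_norm_sq]
      field_simp
      ring
    exact (pow_eq_one_iff_of_nonneg (norm_nonneg _) two_ne_zero).1 h2
  · intro p hp i
    rw [nullNormal, real_inner_smul_left]
    fin_cases i
    · simp only [Fin.zero_eta, hD0 p hp]
      rw [realSurface, inner_crossE3_left, mul_zero]
    · simp only [Fin.mk_one, hD1 p hp]
      rw [realSurface, inner_crossE3_right, mul_zero]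
  · intro p hp
    rw [hD0 p hp]
    exact hpre _ hp
  · intro p hp
    rw [hD0 p hp, hD1 p hp]
    exact (hconf p hp).1
  · intro p hp
    rw [hD0 p hp, hD1 p hp]
    exact (hconf p hp).2
  · intro p hp
    -- The partial derivatives are Re Φ and Re(iΦ), so the Laplacian is Re(Φ' + i²Φ') = 0.
    have hΦ' := (hdΦ.differentiableAt (hU.mem_nhds hp)).hasDerivAt
    have e0 : partialD 0 (realSurface Ψ) =ᶠ[𝓝 p] realSurface Φ :=
      Filter.eventually_of_mem (hΩ.mem_nhds hp) hD0
    have e1 : partialD 1 (realSurface Ψ) =ᶠ[𝓝 p] realSurface (fun z => Complex.I • Φ z) :=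
      Filter.eventually_of_mem (hΩ.mem_nhds hp) hD1
    rw [partialD_congr e0, partialD_congr e1, partialD_realSurface hΦ',
      partialD_realSurface (hΦ'.fun_const_smul Complex.I), toComplex_paramDir_zero,
      toComplex_paramDir_one, smul_smul, Complex.I_mul_I, one_smul, neg_one_smul, map_neg,
      add_neg_cancel]

/-! ### Reduction to the Björling problem for the inverted data -/

theorem mainTheorem5 (I : Set ℝ) (hI : I.OrdConnected) (hI' : I.Nontrivial)
    (α V : ℝ → E3)
    (hα : AnalyticOn ℝ α I) (hα_reg : ∀ s ∈ I, derivWithin α I s ≠ 0)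
    (hV : AnalyticOn ℝ V I) (hV_unit : ∀ s ∈ I, ‖V s‖ = 1)
    (hV_normal : ∀ s ∈ I, inner ℝ (derivWithin α I s) (V s) = 0)
    (hα_ne : ∀ s ∈ I, α s ≠ 0) :
    ∃ (Ω : Set (ℝ × ℝ)) (X ν : ℝ × ℝ → E3),
      IsStationarySurface (-4) Ω X ν ∧
      ∀ s ∈ I, (s, (0 : ℝ)) ∈ Ω ∧ X (s, 0) = α s ∧ ν (s, 0) = V s := by
  have hud := hI.uniqueDiffOn hI'
  have hn : ∀ s ∈ I, ‖α s‖ ≠ 0 := fun s hs => norm_ne_zero_iff.2 (hα_ne s hs)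
  have hcα : ContDiffOn ℝ ω α I := hα.contDiffOn hud
  have hcV : ContDiffOn ℝ ω V I := hV.contDiffOn hud
  let β : ℝ → E3 := fun s => (‖α s‖ ^ 2)⁻¹ • α s
  let N : ℝ → E3 := fun s => V s - (2 * inner ℝ (V s) (α s) / ‖α s‖ ^ 2) • α s
  have hβ : AnalyticOn ℝ β I := ContDiffOn.analyticOn <|
    ((hcα.norm_sq ℝ).inv fun s hs => pow_ne_zero 2 (hn s hs)).smul hcα
  have hN : AnalyticOn ℝ N I := ContDiffOn.analyticOn <|
    hcV.sub (((contDiffOn_const.mul (hcV.inner ℝ hcα)).div (hcα.norm_sq ℝ)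
      fun s hs => pow_ne_zero 2 (hn s hs)).smul hcα)
  have hβ' : ∀ s ∈ I, derivWithin β I s = (‖α s‖ ^ 2)⁻¹ • derivWithin α I s -
      (2 * inner ℝ (α s) (derivWithin α I s) / (‖α s‖ ^ 2) ^ 2) • α s := fun s hs =>
    (hasDerivWithinAt_inversion (hα.differentiableOn s hs).hasDerivWithinAt
      (hα_ne s hs)).derivWithin (hud s hs)
  have hββ : ∀ s ∈ I, inner ℝ (derivWithin β I s) (derivWithin β I s) =
      inner ℝ (derivWithin α I s) (derivWithin α I s) / (‖α s‖ ^ 2) ^ 2 := by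
    intro s hs
    have := hn s hs
    rw [hβ' s hs]
    simp only [inner_sub_left, inner_sub_right, real_inner_smul_left, real_inner_smul_right,
      real_inner_self_eq_norm_sq (α s), real_inner_comm (α s) (derivWithin α I s)]
    field_simp
    ring
  have hβ_reg : ∀ s ∈ I, derivWithin β I s ≠ 0 := by
    intro s hs
    rw [← inner_self_ne_zero (𝕜 := ℝ), hββ s hs]
    exact div_ne_zero (inner_self_ne_zero.2 (hα_reg s hs))
      (pow_ne_zero _ (pow_ne_zero _ (hn s hs)))
  have hN_unit : ∀ s ∈ I, ‖N s‖ = 1 := by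
    intro s hs
    have := hn s hs
    have h : ‖N s‖ ^ 2 = 1 := by
      rw [← real_inner_self_eq_norm_sq]
      simp only [N, inner_sub_left, inner_sub_right, real_inner_smul_left, real_inner_smul_right,
        real_inner_self_eq_norm_sq (α s), real_inner_self_eq_norm_sq (V s),
        real_inner_comm (V s) (α s), hV_unit s hs]
      field_simp
      ring
    exact (pow_eq_one_iff_of_nonneg (norm_nonneg _) two_ne_zero).1 h
  have hN_normal : ∀ s ∈ I, inner ℝ (derivWithin β I s) (N s) = 0 := by
    intro s hs
    have := hn s hs
    rw [hβ' s hs]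
    simp only [N, inner_sub_left, inner_sub_right, real_inner_smul_left, real_inner_smul_right,
      real_inner_self_eq_norm_sq, real_inner_comm (V s) (α s), hV_normal s hs,
      real_inner_comm (α s) (derivWithin α I s)]
    field_simp
    ring
  obtain ⟨U₀, Ψ, Φ, hU₀, hΨ, hΦ0, hnull, hcurve⟩ :=
    exists_null_curve hI hI' hβ hN hβ_reg hN_unit hN_normal
  have hβ0 : ∀ s ∈ I, β s ≠ 0 := fun s hs =>
    smul_ne_zero (inv_ne_zero (pow_ne_zero 2 (hn s hs))) (hα_ne s hs)
  -- The minimal surface may pass through the origin away from β, so those parameters are removed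
  -- before inverting.
  have hopen : IsOpen (U₀ ∩ (fun z => rePart (Ψ z)) ⁻¹' {v | v ≠ 0}) :=
    (rePart.continuous.comp_continuousOn fun z hz =>
      (hΨ z hz).continuousAt.continuousWithinAt).isOpen_inter_preimage hU₀ isOpen_ne
  obtain ⟨U, hUsub, hU, hUc, hIU⟩ := exists_connected_open_subset hI hI'.nonempty hopen
    fun s hs => ⟨(hcurve s hs).1, by
      rw [mem_preimage, (hcurve s hs).2.1]; exact hβ0 s hs⟩
  refine ⟨toComplex ⁻¹' U, _, _, IsStationarySurface.of_null_curve hU hUc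
    (fun z hz => hΨ z (hUsub hz).1) (fun z hz => hΦ0 z (hUsub hz).1)
    (fun z hz => hnull z (hUsub hz).1) (fun z hz => (hUsub hz).2), fun s hs => ?_⟩
  obtain ⟨-, hΨs, hΦs, hIΦs⟩ := hcurve s hs
  have h1 := hn s hs
  have hY : realSurface Ψ (s, 0) = (‖α s‖ ^ 2)⁻¹ • α s := by
    rw [realSurface, toComplex_ofReal, hΨs]
  have hYn : ‖realSurface Ψ (s, 0)‖ ^ 2 = (‖α s‖ ^ 2)⁻¹ := by
    rw [hY, ← real_inner_self_eq_norm_sq, real_inner_smul_left, real_inner_smul_right,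
      real_inner_self_eq_norm_sq]
    field_simp
  have hM : nullNormal Φ (s, 0) = N s := by
    rw [nullNormal, toComplex_ofReal, hΦs, hIΦs, crossE3_crossE3_self, hN_normal s hs, zero_smul,
      sub_zero, smul_smul, real_inner_self_eq_norm_sq,
      inv_mul_cancel₀ (pow_ne_zero 2 (norm_ne_zero_iff.2 (hβ_reg s hs))), one_smul]
  have hNα : inner ℝ (N s) (α s) = -inner ℝ (V s) (α s) := by
    simp only [N, inner_sub_left, real_inner_smul_left, real_inner_self_eq_norm_sq]
    field_simp
    ring
  -- Inverting β gives back α, and reflecting N in the same plane, as β is parallel to α, gives back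
  -- V.
  refine ⟨by rw [mem_preimage, toComplex_ofReal]; exact hIU s hs, ?_, ?_⟩
  · rw [invertSurface, hYn, hY, inv_inv, smul_smul, mul_inv_cancel₀ (pow_ne_zero 2 h1), one_smul]
  · rw [invertNormal, hYn, hM, hY, real_inner_smul_right, hNα]
    simp only [N]
    match_scalars
    · ring
    · field_simp
      ring
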